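/- Let $K$ be an algebraically closed field of characteristic zero, and let $(L,[\cdot,\cdot],\alpha)$ be a finite-dimensional Hom-Lie algebra over $K$; that is, $L$ is a finite-dimensional $K$-vector space, $[\cdot,\cdot]:L\times L\to L$ is bilinear with $[y,x]=-[x,y]$, $\alpha:L\to L$ is linear, and $$[[x,y],\alpha(z)]+[[z,x],\alpha(y)]+[[y,z],\alpha(x)]=0\qquad (x,y,z\in L).$$ Suppose that $L$ is - nilpotent: $L^n=0$ for some $n\ge 1$, where $L^1=L$ and $L^{n}=[L^{n-1},L]$ (the linear span of the brackets) for $n>1$; - multiplicative: $\alpha([x,y])=[\alpha(x),\alpha(y)]$ for all $x,y\in L$; - nondegenerate: $\ker\alpha=0$. Then there exist a finite-dimensional $K$-vector space $V$ and linear maps $\beta:V\to V$ and $\rho:L\to\mathrm{End}(V)$ such that $\rho$ is a representation of $L$ in $(V,\beta)$, i.e. $$\rho([x,y])\circ\beta=\rho(\alpha(x))\circ\rho(y)-\rho(\alpha(y))\circ\rho(x)\qquad (x,y\in L),$$ and this representation is - faithful: $\ker\rho=0$; - nilpotent: there is $n\ge 1$ such that $\rho(x_1)\circ\dots\circ\rho(x_n)=0$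 for all $x_1,\dots,x_n\in L$; - multiplicative: $\rho(\alpha(x))\circ\beta=\beta\circ\rho(x)$ for all $x\in L$; - nondegenerate: $\ker\beta=0$. -/

import Mathlib

universe u v

/-- A Hom-vector space `(V, α)` is nondegenerate if its twist map `α` has zero kernel. -/
def TwistNondegenerate {K V : Type*} [Field K] [AddCommGroup V] [Module K V]
    (α : V →ₗ[K] V) : Prop :=
  LinearMap.ker α = ⊥

/-- The structure of a Hom-Lie algebra on a vector space `L` over `K`: a bilinear
anticommutative bracket and a linear twist map satisfying the Hom-Jacobi identity. -/
structure HomLieAlgebra (K L : Type*) [Field K] [AddCommGroup L] [Module K L] where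
  bracket : L →ₗ[K] L →ₗ[K] L
  twist : L →ₗ[K] L
  anticomm : ∀ x y : L, bracket y x = -bracket x y
  hom_jacobi : ∀ x y z : L,
    bracket (bracket x y) (twist z) + bracket (bracket z x) (twist y)
      + bracket (bracket y z) (twist x) = 0

namespace HomLieAlgebra

variable {K L : Type*} [Field K] [AddCommGroup L] [Module K L]

/-- The twist map is a homomorphism for the bracket. -/
def IsMultiplicative (A : HomLieAlgebra K L) : Prop :=
  ∀ x y : L, A.twist (A.bracket x y) = A.bracket (A.twist x) (A.twist y)

/-- The underlying Hom-vector space is nondegenerate. -/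
def IsNondegenerate (A : HomLieAlgebra K L) : Prop :=
  TwistNondegenerate A.twist

/-- The lower central series, numbered from `0`: with the usual numbering `L^1 = L`,
`L^(n+1) = [L^n, L]` (the linear span of the brackets), `A.lowerCentral n` is `L^(n+1)`. -/
def lowerCentral (A : HomLieAlgebra K L) : ℕ → Submodule K L
  | 0 => ⊤
  | n + 1 => Submodule.map₂ A.bracket (A.lowerCentral n) ⊤

/-- The lower central series reaches zero. -/
def IsNilpotent (A : HomLieAlgebra K L) : Prop :=
  ∃ n : ℕ, A.lowerCentral n = ⊥

/-- A representation of a Hom-Lie algebra in a Hom-vector space `(V, twist)`, where the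
twist map of `V` is part of the data. -/
structure Representation (A : HomLieAlgebra K L)
    (V : Type*) [AddCommGroup V] [Module K V] where
  twist : V →ₗ[K] V
  action : L →ₗ[K] Module.End K V
  action_bracket : ∀ x y : L,
    action (A.bracket x y) ∘ₗ twist =
      action (A.twist x) ∘ₗ action y - action (A.twist y) ∘ₗ action x

namespace Representation

variable {A : HomLieAlgebra K L} {V : Type*} [AddCommGroup V] [Module K V]

/-- `ρ(α(x)) ∘ β = β ∘ ρ(x)` for all `x`. -/
def IsMultiplicative (ρ : A.Representation V) : Prop :=
  ∀ x : L, ρ.action (A.twist x) ∘ₗ ρ.twist = ρ.twist ∘ₗ ρ.action x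

/-- The Hom-vector space carrying the representation is nondegenerate. -/
def IsNondegenerate (ρ : A.Representation V) : Prop :=
  TwistNondegenerate ρ.twist

/-- For some positive `n`, all compositions `ρ(x₁) ∘ ⋯ ∘ ρ(xₙ)` vanish; equivalently, the
associative (nonunital) algebra generated by the image of `ρ` is nilpotent. -/
def IsNilpotent (ρ : A.Representation V) : Prop :=
  ∃ n : ℕ, 0 < n ∧ ∀ x : Fin n → L, (List.ofFn fun i => ρ.action (x i)).prod = 0

/-- The kernel of the linear map `ρ : L → End V` is zero. -/
def IsFaithful (ρ : A.Representation V) : Prop :=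
  LinearMap.ker ρ.action = ⊥

end Representation

end HomLieAlgebra

-- Since `α` is bijective, the Hom-Lie structure can be untwisted: `⁅x, y⁆ = α⁻¹[x, y]` is a
-- nilpotent Lie bracket and `α` is an automorphism of it. Given a faithful nilpotent representation
-- `π` of this Lie algebra and an injective `β` with `π (α x) β = β π x`, the operators `β π x` form
-- the required representation.
--
-- Such a pair comes functorially from the enveloping algebra `U`: let `π` be left multiplication on
-- `U / I ^ n`, where `I` is the augmentation ideal, and let `β` be induced by `α`. The quotient is
-- finite-dimensional, so only faithfulness for large `n` is hard
-- (`exists_ι_mem_augmentationPower_imp_eq_zero`). It goes by induction on dimension, without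
-- Poincaré–Birkhoff–Witt: a functional `φ` killing brackets splits off a line `K x`, and the
-- algebra acts on `U(ker φ)` by left multiplications and the derivation `ad x`. Weighting
-- generators by depth in the lower central series makes every operator raise weight, so a high
-- power of `I` acts into a high augmentation power of `U(ker φ)`, where the inductive hypothesis
-- applies.

attribute [local instance] LieRing.ofAssociativeRing

namespace UniversalEnvelopingAlgebra

/-! ### Powers of the augmentation ideal. -/

section Filtration

variable (K : Type*) [Field K] (g : Type*) [LieRing g] [LieAlgebra K g]

theorem adjoin_range_ι :
    Algebra.adjoin K (Set.range (ι K : g → UniversalEnvelopingAlgebra K g)) = ⊤ := by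
  set S := Algebra.adjoin K (Set.range (ι K : g → UniversalEnvelopingAlgebra K g)) with hS
  let f : g →ₗ⁅K⁆ S :=
    { toFun := fun x => ⟨ι K x, Algebra.subset_adjoin ⟨x, rfl⟩⟩
      map_add' := fun x y => Subtype.ext (map_add (ι K) x y)
      map_smul' := fun c x => Subtype.ext (map_smul (ι K) c x)
      map_lie' := fun {x y} => Subtype.ext (LieHom.map_lie (ι K) x y) }
  have h : S.val.comp (lift K f) = AlgHom.id K _ := by
    apply hom_ext
    ext x
    simp [f]
  refine top_unique fun u _ => ?_
  have := DFunLike.congr_fun h u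
  simp only [AlgHom.comp_apply, AlgHom.id_apply] at this
  rw [← this]
  exact (lift K f u).2

/-- The span of the products of at least `n` generators, that is, the `n`-th power of the
augmentation ideal. -/
def augmentationPower (n : ℕ) : Submodule K (UniversalEnvelopingAlgebra K g) :=
  Submodule.span K {u | ∃ l : List g, n ≤ l.length ∧ (l.map (ι K)).prod = u}

variable {K g}

theorem list_prod_mem_augmentationPower {n : ℕ} {l : List g} (h : n ≤ l.length) :
    (l.map (ι K)).prod ∈ augmentationPower K g n :=
  Submodule.subset_span ⟨l, h, rfl⟩

theorem augmentationPower_antitone : Antitone (augmentationPower K g) := fun _ _ h =>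
  Submodule.span_mono fun _ ⟨l, hl, hu⟩ => ⟨l, h.trans hl, hu⟩

theorem augmentationPower_zero : augmentationPower K g 0 = ⊤ := by
  refine top_unique fun u _ => ?_
  have hu : u ∈ Subalgebra.toSubmodule
      (Algebra.adjoin K (Set.range (ι K : g → UniversalEnvelopingAlgebra K g))) := by
    rw [adjoin_range_ι]; trivial
  rw [Algebra.adjoin_eq_span] at hu
  refine Submodule.span_mono ?_ hu
  intro v hv
  obtain ⟨l, hl, rfl⟩ := Submonoid.exists_list_of_mem_closure hv
  obtain ⟨l', rfl⟩ : l ∈ Set.range (List.map (ι K : g → UniversalEnvelopingAlgebra K g)) := by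
    rw [Set.range_list_map]; exact hl
  exact ⟨l', Nat.zero_le _, rfl⟩

theorem ι_mul_mem_augmentationPower {n : ℕ} (x : g) {u : UniversalEnvelopingAlgebra K g}
    (hu : u ∈ augmentationPower K g n) : ι K x * u ∈ augmentationPower K g (n + 1) := by
  induction hu using Submodule.span_induction with
  | mem u hu =>
    obtain ⟨l, hl, rfl⟩ := hu
    exact Submodule.subset_span ⟨x :: l, by simpa using hl, by simp⟩
  | zero => simp
  | add u v _ _ hu hv => rw [mul_add]; exact add_mem hu hv
  | smul c u _ hu => rw [mul_smul_comm]; exact Submodule.smul_mem _ _ hu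

/-- Monomials of length at most `n` lie in the finitely generated space `(K + ι g) ^ n`; longer ones
vanish in the quotient. -/
theorem finite_quotient_augmentationPower [FiniteDimensional K g] (n : ℕ) :
    FiniteDimensional K (UniversalEnvelopingAlgebra K g ⧸ augmentationPower K g n) := by
  set N : Submodule K (UniversalEnvelopingAlgebra K g) :=
    1 ⊔ LinearMap.range (ι K : g →ₗ⁅K⁆ UniversalEnvelopingAlgebra K g).toLinearMap with hN
  have hone : (1 : UniversalEnvelopingAlgebra K g) ∈ N :=
    Submodule.mem_sup_left (Submodule.one_le.1 le_rfl)
  have hfg : (N ^ n).FG := by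
    refine Submodule.FG.pow (Submodule.FG.sup ?_ ?_) n
    · rw [Submodule.one_eq_span]; exact Submodule.fg_span_singleton _
    · rw [LinearMap.range_eq_map]; exact Submodule.FG.map _ (Module.finite_def.1 inferInstance)
  have hmem : ∀ l : List g, l.length ≤ n → (l.map (ι K)).prod ∈ N ^ n := by
    intro l hl
    have h1 : (l.map (ι K)).prod ∈ N ^ l.length := by
      clear hl
      induction l with
      | nil =>
        rw [List.map_nil, List.prod_nil, List.length_nil, pow_zero]
        exact Submodule.one_le.1 le_rfl
      | cons x l ih =>
        rw [List.map_cons, List.prod_cons, List.length_cons, pow_succ']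
        exact Submodule.mul_mem_mul (Submodule.mem_sup_right ⟨x, rfl⟩) ih
    exact pow_le_pow_right₀ (Submodule.one_le.2 hone) hl h1
  have hsurj : (N ^ n).map (augmentationPower K g n).mkQ = ⊤ := by
    refine top_unique ?_
    rw [← Submodule.range_mkQ (augmentationPower K g n), LinearMap.range_eq_map,
      ← augmentationPower_zero, Submodule.map_le_iff_le_comap]
    refine Submodule.span_le.2 ?_
    rintro _ ⟨l, -, rfl⟩
    rw [SetLike.mem_coe, Submodule.mem_comap]
    rcases le_total n l.length with h | h
    · have : (augmentationPower K g n).mkQ (l.map (ι K)).prod = 0 := by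
        simpa using list_prod_mem_augmentationPower h
      rw [this]; exact zero_mem _
    · exact Submodule.mem_map_of_mem (hmem l h)
  exact Module.finite_def.2 (hsurj ▸ hfg.map _)

end Filtration

/-! ### Extending derivations to the enveloping algebra. -/

section Derivation

variable {K : Type*} [Field K] {h : Type*} [LieRing h] [LieAlgebra K h]

/-- The algebra map `u ↦ u + ε D(u)`, where `D` extends the derivation `δ`. -/
noncomputable def derivationLift (δ : LieDerivation K h h) :
    UniversalEnvelopingAlgebra K h →ₐ[K] DualNumber (UniversalEnvelopingAlgebra K h) :=
  lift K
    { toFun := fun x => TrivSqZeroExt.inl (ι K x) + TrivSqZeroExt.inr (ι K (δ x))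
      map_add' := fun x y => by ext <;> simp
      map_smul' := fun c x => by ext <;> simp
      map_lie' := fun {x y} => by
        ext
        · simp [LieRing.of_associative_ring_bracket, -ι_apply]
        · simp [LieRing.of_associative_ring_bracket, -ι_apply]; abel }

/-- The extension of a derivation of a Lie algebra to its universal enveloping algebra. -/
noncomputable def derivationExtension (δ : LieDerivation K h h) :
    UniversalEnvelopingAlgebra K h →ₗ[K] UniversalEnvelopingAlgebra K h where
  toFun u := (derivationLift δ u).snd
  map_add' u v := by simp
  map_smul' c u := by simp

theorem derivationLift_ι (δ : LieDerivation K h h) (x : h) :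
    derivationLift δ (ι K x) = TrivSqZeroExt.inl (ι K x) + TrivSqZeroExt.inr (ι K (δ x)) :=
  lift_ι_apply K _ x

theorem derivationExtension_one (δ : LieDerivation K h h) : derivationExtension δ 1 = 0 := by
  simp [derivationExtension]

theorem fst_derivationLift (δ : LieDerivation K h h) (u : UniversalEnvelopingAlgebra K h) :
    (derivationLift δ u).fst = u := by
  have : (TrivSqZeroExt.fstHom K _ _).comp (derivationLift δ) = AlgHom.id K _ := by
    apply hom_ext
    ext x
    simp [derivationLift_ι, -ι_apply]
  exact DFunLike.congr_fun this u

/-- This is the `ε`-coefficient of the multiplicativity of `u ↦ u + ε D(u)`. -/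
theorem derivationExtension_ι_mul (δ : LieDerivation K h h) (x : h)
    (u : UniversalEnvelopingAlgebra K h) :
    derivationExtension δ (ι K x * u) = ι K (δ x) * u + ι K x * derivationExtension δ u := by
  simp only [derivationExtension, LinearMap.coe_mk, AddHom.coe_mk, map_mul,
    TrivSqZeroExt.snd_mul, fst_derivationLift, derivationLift_ι]
  simp [add_comm, -ι_apply]

end Derivation

/-! ### Filtration of the enveloping algebra by weight. -/

section Weights

variable {K : Type*} [Field K] {h : Type*} [LieRing h] [LieAlgebra K h]

/-- Products of generators, where a generator in `F j` may be counted with weight `j + 1`. -/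
inductive IsWeightedMonomial (F : ℕ → Submodule K h) :
    ℕ → UniversalEnvelopingAlgebra K h → Prop
  | one : IsWeightedMonomial F 0 1
  | ι_mul {j w : ℕ} {x : h} {u : UniversalEnvelopingAlgebra K h} (hx : x ∈ F j)
      (hu : IsWeightedMonomial F w u) : IsWeightedMonomial F (w + (j + 1)) (ι K x * u)

/-- The span of the products of generators of weight at least `w`. -/
def weightFiltration (F : ℕ → Submodule K h) (w : ℕ) :
    Submodule K (UniversalEnvelopingAlgebra K h) :=
  Submodule.span K {u | ∃ v, w ≤ v ∧ IsWeightedMonomial F v u}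

theorem weightFiltration_antitone (F : ℕ → Submodule K h) : Antitone (weightFiltration F) :=
  fun _ _ hw => Submodule.span_mono fun _ ⟨v, hv, hu⟩ => ⟨v, hw.trans hv, hu⟩

theorem ι_mul_mem_weightFiltration {F : ℕ → Submodule K h} {j w : ℕ} {x : h} (hx : x ∈ F j)
    {u : UniversalEnvelopingAlgebra K h} (hu : u ∈ weightFiltration F w) :
    ι K x * u ∈ weightFiltration F (w + (j + 1)) := by
  induction hu using Submodule.span_induction with
  | mem u hu =>
    obtain ⟨v, hv, hu⟩ := hu
    exact Submodule.subset_span ⟨v + (j + 1), by lia, .ι_mul hx hu⟩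
  | zero => simp
  | add u v _ _ hu hv => rw [mul_add]; exact add_mem hu hv
  | smul c u _ hu => rw [mul_smul_comm]; exact Submodule.smul_mem _ _ hu

theorem weightFiltration_zero {F : ℕ → Submodule K h} (hF : F 0 = ⊤) :
    weightFiltration F 0 = ⊤ := by
  rw [eq_top_iff, ← augmentationPower_zero, augmentationPower, Submodule.span_le]
  rintro _ ⟨l, -, rfl⟩
  induction l with
  | nil => exact Submodule.subset_span ⟨0, le_rfl, .one⟩
  | cons x l ih =>
    rw [List.map_cons, List.prod_cons]
    exact weightFiltration_antitone F (Nat.zero_le _)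
      (ι_mul_mem_weightFiltration (j := 0) (by simp [hF]) ih)

/-- By the Leibniz rule, each term of the derivative of a monomial has one factor moved one step
deeper in `F`. -/
theorem derivationExtension_mem_weightFiltration {F : ℕ → Submodule K h}
    {δ : LieDerivation K h h} (hδ : ∀ j, ∀ x ∈ F j, δ x ∈ F (j + 1)) {w : ℕ}
    {u : UniversalEnvelopingAlgebra K h} (hu : u ∈ weightFiltration F w) :
    derivationExtension δ u ∈ weightFiltration F (w + 1) := by
  induction hu using Submodule.span_induction with
  | mem u hu =>
    obtain ⟨v, hv, hu⟩ := hu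
    refine weightFiltration_antitone F (Nat.succ_le_succ hv) ?_
    clear hv
    induction hu with
    | one => rw [derivationExtension_one]; exact zero_mem _
    | @ι_mul j w x u hx hu ih =>
      rw [derivationExtension_ι_mul]
      refine add_mem ?_ ?_
      · exact ι_mul_mem_weightFiltration (hδ j x hx) (Submodule.subset_span ⟨w, le_rfl, hu⟩)
      · refine weightFiltration_antitone F ?_ (ι_mul_mem_weightFiltration hx ih)
        lia
  | zero => simp
  | add u v _ _ hu hv => rw [map_add]; exact add_mem hu hv
  | smul c u _ hu => rw [map_smul]; exact Submodule.smul_mem _ _ hu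

/-- A nonzero factor counts for weight at most `c`, because `F c = ⊥`; so weight `n * c` forces at
least `n` factors. -/
theorem weightFiltration_le_augmentationPower {F : ℕ → Submodule K h} (hF : Antitone F) {c : ℕ}
    (hcpos : 0 < c) (hc : F c = ⊥) (n : ℕ) : weightFiltration F (n * c) ≤ augmentationPower K h n := by
  have key : ∀ v u, IsWeightedMonomial F v u →
      ∃ k, u ∈ augmentationPower K h k ∧ (u = 0 ∨ v ≤ k * c) := by
    intro v u hu
    induction hu with
    | one => exact ⟨0, by simp [augmentationPower_zero], by simp⟩
    | @ι_mul j w x u hx hu ih =>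
      obtain ⟨k, hk, h0⟩ := ih
      refine ⟨k + 1, ι_mul_mem_augmentationPower x hk, ?_⟩
      rcases h0 with rfl | h0
      · simp
      rcases lt_or_ge j c with hj | hj
      · right; rw [add_mul]; lia
      · left
        have : x ∈ F c := hF hj hx
        rw [hc, Submodule.mem_bot] at this
        simp [this]
  refine Submodule.span_le.2 ?_
  rintro u ⟨v, hv, hu⟩
  obtain ⟨k, hk, rfl | h0⟩ := key v u hu
  · exact zero_mem _
  · exact augmentationPower_antitone (Nat.le_of_mul_le_mul_right (hv.trans h0) hcpos) hk

end Weights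

end UniversalEnvelopingAlgebra

namespace UniversalEnvelopingAlgebra

/-! ### Action of a Lie algebra on the enveloping algebra of a codimension-one ideal. -/

section Extension

variable {K : Type*} [Field K] {g : Type*} [LieRing g] [LieAlgebra K g]

theorem coe_lie_lieIdeal (I : LieIdeal K g) (a b : I) : ((⁅a, b⁆ : I) : g) = ⁅(a : g), (b : g)⁆ :=
  rfl

/-- The derivation induced on an ideal by an element of the ambient Lie algebra. -/
def idealDerivation (I : LieIdeal K g) (x : g) : LieDerivation K I I where
  toLinearMap := LieModule.toEnd K g I x
  leibniz' a b := by
    ext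
    simp only [LieModule.toEnd_apply_apply, LieSubmodule.coe_bracket, LieSubmodule.coe_sub,
      coe_lie_lieIdeal]
    rw [leibniz_lie x (a : g) (b : g), ← lie_skew ⁅x, (a : g)⁆ (b : g)]
    abel

theorem coe_idealDerivation (I : LieIdeal K g) (x : g) (a : I) :
    (idealDerivation I x a : g) = ⁅x, (a : g)⁆ := rfl

variable {φ : g →ₗ[K] K} {x : g}

/-- The kernel of a linear functional that vanishes on brackets. -/
def kerIdeal (φ : g →ₗ[K] K) (hφ : ∀ y z : g, φ ⁅y, z⁆ = 0) : LieIdeal K g :=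
  { LinearMap.ker φ with lie_mem := fun {y z} _ => hφ y z }

theorem mem_kerIdeal (hφ : ∀ y z : g, φ ⁅y, z⁆ = 0) {y : g} : y ∈ kerIdeal φ hφ ↔ φ y = 0 :=
  LinearMap.mem_ker

/-- The projection to the kernel of `φ` along the line spanned by `x`. -/
def kerProjection (hφ : ∀ y z : g, φ ⁅y, z⁆ = 0) (hx : φ x = 1) : g →ₗ[K] kerIdeal φ hφ where
  toFun y := ⟨y - φ y • x, (mem_kerIdeal hφ).2 (by simp [hx])⟩
  map_add' y z := Subtype.ext (by simp only [map_add, add_smul]; exact add_sub_add_comm _ _ _ _)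
  map_smul' c y := Subtype.ext (by simp [smul_sub, mul_smul])

theorem coe_kerProjection (hφ : ∀ y z : g, φ ⁅y, z⁆ = 0) (hx : φ x = 1) (y : g) :
    (kerProjection hφ hx y : g) = y - φ y • x := rfl

theorem kerProjection_lie (hφ : ∀ y z : g, φ ⁅y, z⁆ = 0) (hx : φ x = 1) (y z : g) :
    kerProjection hφ hx ⁅y, z⁆ = ⁅kerProjection hφ hx y, kerProjection hφ hx z⁆
      + φ y • idealDerivation _ x (kerProjection hφ hx z)
      - φ z • idealDerivation _ x (kerProjection hφ hx y) := by
  ext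
  simp only [LieSubmodule.coe_sub, LieSubmodule.coe_add, LieSubmodule.coe_smul,
    coe_lie_lieIdeal, coe_idealDerivation, coe_kerProjection, hφ, lie_sub, sub_lie, lie_smul,
    smul_lie, lie_self, smul_zero, zero_smul, sub_zero]
  rw [← lie_skew y x, smul_neg]
  abel

/-- The action of `g` on the enveloping algebra of the kernel of `φ`: elements of the kernel act by
left multiplication, and the complementary element `x` acts as a derivation. -/
noncomputable def extensionAction (hφ : ∀ y z : g, φ ⁅y, z⁆ = 0) (hx : φ x = 1) :
    g →ₗ⁅K⁆ Module.End K (UniversalEnvelopingAlgebra K (kerIdeal φ hφ)) where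
  toFun y := LinearMap.mulLeft K (ι K (kerProjection hφ hx y))
    + φ y • derivationExtension (idealDerivation _ x)
  map_add' y z := by
    ext u
    simp only [map_add, add_smul, LinearMap.add_apply, LinearMap.mulLeft_apply, add_mul,
      LinearMap.smul_apply]
    abel
  map_smul' c y := by
    ext u
    simp [mul_smul, -ι_apply]
  map_lie' {y z} := by
    ext u
    simp only [kerProjection_lie, hφ, map_add, map_sub, map_smul, LieHom.map_lie,
      LieRing.of_associative_ring_bracket, LinearMap.add_apply, LinearMap.mulLeft_apply,
      LinearMap.sub_apply, Module.End.mul_apply, LinearMap.smul_apply, zero_smul, add_zero,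
      derivationExtension_ι_mul, add_mul, sub_mul, mul_add, smul_mul_assoc, mul_smul_comm,
      smul_add, mul_assoc, smul_smul, mul_comm (φ z) (φ y)]
    abel

theorem extensionAction_apply (hφ : ∀ y z : g, φ ⁅y, z⁆ = 0) (hx : φ x = 1) (y : g)
    (u : UniversalEnvelopingAlgebra K (kerIdeal φ hφ)) :
    extensionAction hφ hx y u = ι K (kerProjection hφ hx y) * u
      + φ y • derivationExtension (idealDerivation _ x) u := rfl

/-- The elements of an ideal in a term of the lower central series of the ambient Lie algebra. -/
def idealSeries (I : LieIdeal K g) (j : ℕ) : Submodule K I :=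
  (LieModule.lowerCentralSeries K g g j).toSubmodule.comap I.toSubmodule.subtype

theorem idealSeries_zero (I : LieIdeal K g) : idealSeries I 0 = ⊤ := by
  simp [idealSeries]

theorem idealSeries_antitone (I : LieIdeal K g) : Antitone (idealSeries I) := fun _ _ h =>
  Submodule.comap_mono (LieModule.antitone_lowerCentralSeries K g g h)

theorem idealDerivation_mem_idealSeries (I : LieIdeal K g) (x : g) (j : ℕ) (a : I)
    (ha : a ∈ idealSeries I j) : idealDerivation I x a ∈ idealSeries I (j + 1) := by
  change ⁅x, (a : g)⁆ ∈ LieModule.lowerCentralSeries K g g (j + 1)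
  rw [LieModule.lowerCentralSeries_succ]
  exact LieSubmodule.lie_mem_lie (LieSubmodule.mem_top x) ha

theorem extensionAction_mem_weightFiltration (hφ : ∀ y z : g, φ ⁅y, z⁆ = 0) (hx : φ x = 1)
    (y : g) {w : ℕ} {u : UniversalEnvelopingAlgebra K (kerIdeal φ hφ)}
    (hu : u ∈ weightFiltration (idealSeries _) w) :
    extensionAction hφ hx y u ∈ weightFiltration (idealSeries _) (w + 1) := by
  rw [extensionAction_apply]
  refine add_mem ?_ (Submodule.smul_mem _ _ ?_)
  · exact ι_mul_mem_weightFiltration (j := 0) (by simp [idealSeries_zero]) hu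
  · exact derivationExtension_mem_weightFiltration (idealDerivation_mem_idealSeries _ x) hu

theorem lift_extensionAction_mem_weightFiltration (hφ : ∀ y z : g, φ ⁅y, z⁆ = 0) (hx : φ x = 1)
    {m : ℕ} {u : UniversalEnvelopingAlgebra K g} (hu : u ∈ augmentationPower K g m)
    (v : UniversalEnvelopingAlgebra K (kerIdeal φ hφ)) :
    lift K (extensionAction hφ hx) u v ∈ weightFiltration (idealSeries _) m := by
  induction hu using Submodule.span_induction with
  | mem u hu =>
    obtain ⟨l, hl, rfl⟩ := hu
    refine weightFiltration_antitone _ hl ?_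
    clear hl
    induction l with
    | nil => simp [weightFiltration_zero, idealSeries_zero]
    | cons y l ih =>
      rw [List.map_cons, List.prod_cons, map_mul, lift_ι_apply, Module.End.mul_apply]
      exact extensionAction_mem_weightFiltration hφ hx y ih
  | zero => simp
  | add u w _ _ hu hw => rw [map_add]; exact add_mem hu hw
  | smul c u _ hu => rw [map_smul]; exact Submodule.smul_mem _ _ hu

/-- A functional that vanishes on brackets vanishes on the square of the augmentation ideal. -/
theorem functional_eq_zero_of_ι_mem (hφ : ∀ y z : g, φ ⁅y, z⁆ = 0) {y : g}
    (hy : ι K y ∈ augmentationPower K g 2) : φ y = 0 := by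
  -- `y ↦ ε φ(y)` is a Lie map into a commutative algebra, and `ε² = 0` kills products of two
  -- generators.
  let f : g →ₗ⁅K⁆ DualNumber K :=
    { toFun := fun y => TrivSqZeroExt.inr (φ y)
      map_add' := fun y z => by rw [map_add, TrivSqZeroExt.inr_add]
      map_smul' := fun c y => by rw [map_smul, TrivSqZeroExt.inr_smul]; rfl
      map_lie' := fun {y z} => by simp [hφ, LieRing.of_associative_ring_bracket] }
  have hf : ∀ y, lift K f (ι K y) = TrivSqZeroExt.inr (φ y) := lift_ι_apply K f
  have key : augmentationPower K g 2 ≤ LinearMap.ker (lift K f).toLinearMap := by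
    refine Submodule.span_le.2 ?_
    rintro _ ⟨l, hl, rfl⟩
    match l, hl with
    | a :: b :: l, _ =>
      simp only [List.map_cons, List.prod_cons, SetLike.mem_coe, LinearMap.mem_ker,
        AlgHom.toLinearMap_apply, map_mul, hf]
      rw [← mul_assoc, TrivSqZeroExt.inr_mul_inr, zero_mul]
  have h0 : lift K f (ι K y) = 0 := key hy
  rw [hf] at h0
  exact TrivSqZeroExt.inr_injective (h0.trans (TrivSqZeroExt.inr_zero K).symm)

end Extension

/-! ### Embedding a nilpotent Lie algebra in a truncated enveloping algebra. -/

section Birkhoff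

variable {K : Type*} [Field K]

/-- A nonzero nilpotent algebra is solvable, so its derived ideal is proper. -/
theorem exists_functional_vanishing_on_lie (g : Type*) [LieRing g] [LieAlgebra K g]
    [LieRing.IsNilpotent g] [Nontrivial g] :
    ∃ (φ : g →ₗ[K] K) (x : g), (∀ y z : g, φ ⁅y, z⁆ = 0) ∧ φ x = 1 := by
  have hlt : (LieAlgebra.derivedSeries K g 1).toSubmodule < ⊤ := by
    have := LieAlgebra.derivedSeries_lt_top_of_solvable K g
    exact lt_top_iff_ne_top.2 fun h => this.ne (by simpa using h)
  obtain ⟨φ, hφ0, hφ⟩ := Submodule.exists_le_ker_of_lt_top _ hlt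
  obtain ⟨x, hx⟩ : ∃ x, φ x ≠ 0 := by
    by_contra! h
    exact hφ0 (LinearMap.ext h)
  refine ⟨φ, (φ x)⁻¹ • x, fun y z => hφ ?_, by simp [hx]⟩
  exact LieSubmodule.lie_mem_lie (LieSubmodule.mem_top y) (LieSubmodule.mem_top z)

/-- A finite-dimensional nilpotent Lie algebra embeds into the quotient of its enveloping algebra
by some power of the augmentation ideal. -/
theorem exists_ι_mem_augmentationPower_imp_eq_zero (g : Type*) [LieRing g] [LieAlgebra K g]
    [FiniteDimensional K g] [LieRing.IsNilpotent g] :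
    ∃ n : ℕ, ∀ y : g, ι K y ∈ augmentationPower K g n → y = 0 := by
  induction hd : Module.finrank K g using Nat.strong_induction_on generalizing g with
  | _ d ih =>
    rcases subsingleton_or_nontrivial g with hs | hs
    · exact ⟨0, fun y _ => Subsingleton.elim _ _⟩
    obtain ⟨φ, x, hφ, hx⟩ := exists_functional_vanishing_on_lie (K := K) g
    have hdim : Module.finrank K (kerIdeal φ hφ) < d := by
      rw [← hd]
      refine Submodule.finrank_lt (s := (kerIdeal φ hφ).toSubmodule) fun h => ?_
      have : x ∈ (kerIdeal φ hφ).toSubmodule := h ▸ Submodule.mem_top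
      exact one_ne_zero (hx.symm.trans ((mem_kerIdeal hφ).1 this))
    have : LieRing.IsNilpotent (kerIdeal φ hφ) :=
      Function.Injective.lieAlgebra_isNilpotent (R := K) (f := (kerIdeal φ hφ).incl)
        Subtype.val_injective
    obtain ⟨n, hn⟩ := ih _ hdim (kerIdeal φ hφ) rfl
    obtain ⟨c, hc⟩ := LieModule.IsNilpotent.nilpotent K g g
    have hc' : idealSeries (kerIdeal φ hφ) (c + 1) = ⊥ := by
      refine eq_bot_iff.2 ((idealSeries_antitone _ (Nat.le_succ c)).trans ?_)
      intro a ha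
      have : (a : g) ∈ LieModule.lowerCentralSeries K g g c := ha
      rw [hc, LieSubmodule.mem_bot] at this
      exact (Submodule.mem_bot K).2 (Subtype.ext this)
    -- Exponent `2` forces `φ y = 0`. Then `y` sends `1` to `ι y` in `U(ker φ)`, and exponent `n *
    -- (c + 1)` puts this in the `n`-th augmentation power.
    refine ⟨max 2 (n * (c + 1)), fun y hy => ?_⟩
    have hy0 : φ y = 0 :=
      functional_eq_zero_of_ι_mem hφ (augmentationPower_antitone (le_max_left _ _) hy)
    have h1 := weightFiltration_le_augmentationPower (idealSeries_antitone _) c.succ_pos hc' n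
      (lift_extensionAction_mem_weightFiltration hφ hx
        (augmentationPower_antitone (le_max_right _ _) hy) 1)
    rw [lift_ι_apply, extensionAction_apply, hy0, zero_smul, add_zero, mul_one] at h1
    have h2 := congrArg Subtype.val (hn _ h1)
    rwa [coe_kerProjection, hy0, zero_smul, sub_zero] at h2

end Birkhoff

/-! ### The truncated enveloping algebra as an equivariant representation. -/

section Equivariant

variable {K : Type*} [Field K] {g : Type*} [LieRing g] [LieAlgebra K g]

/-- The map of enveloping algebras induced by a map of Lie algebras. -/
noncomputable def mapHom (α : g →ₗ⁅K⁆ g) :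
    UniversalEnvelopingAlgebra K g →ₐ[K] UniversalEnvelopingAlgebra K g :=
  lift K ((ι K).comp α)

theorem mapHom_ι (α : g →ₗ⁅K⁆ g) (x : g) : mapHom α (ι K x) = ι K (α x) :=
  lift_ι_apply K _ x

theorem mapHom_mem_augmentationPower (α : g →ₗ⁅K⁆ g) (n : ℕ) :
    augmentationPower K g n ≤ (augmentationPower K g n).comap (mapHom α).toLinearMap := by
  refine Submodule.span_le.2 ?_
  rintro _ ⟨l, hl, rfl⟩
  refine Submodule.subset_span ⟨l.map α, by simpa using hl, ?_⟩
  rw [AlgHom.toLinearMap_apply, map_list_prod, List.map_map, List.map_map]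
  congr 1
  exact List.map_congr_left fun x _ => (mapHom_ι α x).symm

theorem mapHom_surjective (α : g →ₗ⁅K⁆ g) (hα : Function.Surjective α) :
    Function.Surjective (mapHom α) := by
  rw [← AlgHom.range_eq_top, eq_top_iff, ← adjoin_range_ι, Algebra.adjoin_le_iff]
  rintro _ ⟨x, rfl⟩
  obtain ⟨y, rfl⟩ := hα x
  exact ⟨ι K y, mapHom_ι α y⟩

theorem exists_equivariant_representation [FiniteDimensional K g] [LieRing.IsNilpotent g]
    (α : g →ₗ⁅K⁆ g) (hα : Function.Surjective α) :
    ∃ (d n : ℕ) (π : g →ₗ[K] Module.End K (Fin d → K)) (β : Module.End K (Fin d → K)),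
      (∀ x y, π ⁅x, y⁆ = π x * π y - π y * π x) ∧ LinearMap.ker π = ⊥ ∧
      (∀ l : List g, n ≤ l.length → (l.map π).prod = 0) ∧
      (∀ x, π (α x) * β = β * π x) ∧ LinearMap.ker β = ⊥ := by
  obtain ⟨n, hn⟩ := exists_ι_mem_augmentationPower_imp_eq_zero (K := K) g
  have hfin := finite_quotient_augmentationPower (K := K) (g := g) n
  set I := augmentationPower K g n with hI
  have hmul : ∀ x : g, I ≤ I.comap (LinearMap.mulLeft K (ι K x)) := fun x u hu =>
    augmentationPower_antitone (Nat.le_succ n) (ι_mul_mem_augmentationPower x hu)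
  let π : g →ₗ[K] Module.End K (UniversalEnvelopingAlgebra K g ⧸ I) :=
    { toFun := fun x => I.mapQ I (LinearMap.mulLeft K (ι K x)) (hmul x)
      map_add' := fun x y => by
        refine Submodule.linearMap_qext _ (LinearMap.ext fun u => ?_)
        simp [add_mul, -ι_apply]
      map_smul' := fun c x => by
        refine Submodule.linearMap_qext _ (LinearMap.ext fun u => ?_)
        simp [-ι_apply] }
  have hπ : ∀ x u, π x (I.mkQ u) = I.mkQ (ι K x * u) := fun x u => rfl
  let β : Module.End K (UniversalEnvelopingAlgebra K g ⧸ I) :=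
    I.mapQ I (mapHom α).toLinearMap (mapHom_mem_augmentationPower α n)
  have hβ : ∀ u, β (I.mkQ u) = I.mkQ (mapHom α u) := fun u => rfl
  -- Coordinates move the representation to `K ^ d`, which lies in the universe of `K`.
  let e := (Module.finBasis K (UniversalEnvelopingAlgebra K g ⧸ I)).equivFun
  let E := LinearEquiv.conjAlgEquiv K e
  -- Surjectivity, unlike injectivity, passes to the quotient; finite dimension then gives
  -- injectivity back.
  have hsurj : Function.Surjective β := by
    intro v
    obtain ⟨u, rfl⟩ := I.mkQ_surjective v
    obtain ⟨w, rfl⟩ := mapHom_surjective α hα u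
    exact ⟨I.mkQ w, rfl⟩
  have hker : LinearMap.ker β = ⊥ :=
    LinearMap.ker_eq_bot.2 (LinearMap.injective_iff_surjective.2 hsurj)
  have hlist : ∀ (l : List g) (u), (l.map π).prod (I.mkQ u) = I.mkQ ((l.map (ι K)).prod * u) := by
    intro l u
    induction l with
    | nil => simp
    | cons x l ih =>
      simp only [List.map_cons, List.prod_cons, Module.End.mul_apply, ih, hπ, mul_assoc]
  refine ⟨_, n, E.toLinearMap ∘ₗ π, E β, ?_, ?_, ?_, ?_, ?_⟩
  · intro x y
    simp only [LinearMap.comp_apply, AlgEquiv.toLinearMap_apply, ← map_mul, ← map_sub]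
    congr 1
    refine Submodule.linearMap_qext _ (LinearMap.ext fun u => ?_)
    simp only [LinearMap.comp_apply, hπ, LinearMap.sub_apply, Module.End.mul_apply, ← map_sub,
      LieHom.map_lie, LieRing.of_associative_ring_bracket, sub_mul, mul_assoc]
  · rw [LinearMap.ker_eq_bot']
    intro x hx
    have hx0 : π x = 0 := by simpa using hx
    apply hn
    -- The class of `1` detects `x`: its image under `π x` is the class of `ι x`.
    have := hπ x 1
    rw [hx0, LinearMap.zero_apply, mul_one] at this
    exact (Submodule.Quotient.mk_eq_zero I).1 this.symm
  · intro l hl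
    have h0 : (l.map π).prod = 0 := by
      refine Submodule.linearMap_qext _ (LinearMap.ext fun u => ?_)
      rw [LinearMap.comp_apply, hlist]
      have hmem : ∀ l' : List g, (l.map (ι K)).prod * (l'.map (ι K)).prod ∈ I := fun l' => by
        rw [← List.prod_append, ← List.map_append]
        exact list_prod_mem_augmentationPower (by simp; lia)
      refine (Submodule.Quotient.mk_eq_zero I).2 ?_
      have hu : u ∈ augmentationPower K g 0 := by rw [augmentationPower_zero]; trivial
      induction hu using Submodule.span_induction with
      | mem u hu => obtain ⟨l', -, rfl⟩ := hu; exact hmem l'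
      | zero => simp
      | add u v _ _ hu hv => rw [mul_add]; exact add_mem hu hv
      | smul c u _ hu => rw [mul_smul_comm]; exact Submodule.smul_mem _ _ hu
    have := map_list_prod E (l.map π)
    rw [h0, map_zero, List.map_map] at this
    exact this.symm
  · intro x
    simp only [LinearMap.comp_apply, AlgEquiv.toLinearMap_apply, ← map_mul]
    congr 1
    refine Submodule.linearMap_qext _ (LinearMap.ext fun u => ?_)
    simp only [LinearMap.comp_apply, hπ, hβ, Module.End.mul_apply, map_mul, mapHom_ι]
  · rw [LinearMap.ker_eq_bot'] at hker ⊢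
    intro v hv
    have h1 : e (β (e.symm v)) = 0 := hv
    have h2 := hker _ (e.map_eq_zero_iff.1 h1)
    simpa using h2

end Equivariant

end UniversalEnvelopingAlgebra

/-! ### Untwisting the Hom-Lie algebra and twisting the representation. -/

namespace HomLieAlgebra

/-- A composition of operators `β ∘ π x` with `π (α x) ∘ β = β ∘ π x` is a power of `β` composed
with a product of operators `π x`. -/
theorem exists_list_prod_twisted {K L V : Type*} [Field K] [AddCommGroup V]
    [Module K V] {α : L → L}
    {π : L → Module.End K V} {β : Module.End K V} (hβ : ∀ x, π (α x) * β = β * π x)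
    (l : List L) :
    ∃ l' : List L, l'.length = l.length ∧
      (l.map fun x => β * π x).prod = (l'.map π).prod * β ^ l.length := by
  have hcomm : ∀ l : List L, β * (l.map π).prod = ((l.map α).map π).prod * β := by
    intro l
    induction l with
    | nil => simp
    | cons x l ih =>
      simp only [List.map_cons, List.prod_cons, mul_assoc]
      rw [← ih, ← mul_assoc, ← mul_assoc, hβ]
  induction l with
  | nil => exact ⟨[], rfl, by simp⟩
  | cons x l ih =>
    obtain ⟨l', hl', h⟩ := ih
    -- Moving the leading `β` to the right past the product applies `α` to every entry.
    refine ⟨(x :: l').map α, by simp [hl'], ?_⟩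
    rw [List.map_cons, List.prod_cons, h, List.length_cons, pow_succ', ← mul_assoc, mul_assoc β,
      ← List.prod_cons, ← List.map_cons, hcomm, mul_assoc]

variable {K L : Type*} [Field K] [AddCommGroup L] [Module K L] {A : HomLieAlgebra K L}

theorem IsMultiplicative.symm_bracket (hmul : A.IsMultiplicative) {a : L ≃ₗ[K] L}
    (ha : ∀ x, a x = A.twist x) (x y : L) :
    a.symm (A.bracket x y) = A.bracket (a.symm x) (a.symm y) := by
  rw [LinearEquiv.symm_apply_eq, ha, hmul, ← ha, ← ha, a.apply_symm_apply, a.apply_symm_apply]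

theorem symm_mem_lowerCentral (hmul : A.IsMultiplicative) {a : L ≃ₗ[K] L}
    (ha : ∀ x, a x = A.twist x) (n : ℕ) :
    A.lowerCentral n ≤ (A.lowerCentral n).comap (a.symm : L →ₗ[K] L) := by
  induction n with
  | zero => exact fun _ _ => Submodule.mem_top
  | succ n ih =>
    refine Submodule.map₂_le.2 fun x hx y _ => ?_
    rw [Submodule.mem_comap, LinearEquiv.coe_coe, hmul.symm_bracket ha]
    exact Submodule.apply_mem_map₂ _ (ih hx) Submodule.mem_top

variable [CharZero K]

/-- The Lie bracket `α⁻¹[x, y]` on a multiplicative Hom-Lie algebra with bijective twist `α`. -/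
abbrev untwistedLieRing (hmul : A.IsMultiplicative) {a : L ≃ₗ[K] L}
    (ha : ∀ x, a x = A.twist x) : LieRing L where
  bracket x y := a.symm (A.bracket x y)
  add_lie x y z := by simp
  lie_add x y z := by simp
  lie_self x := by
    change a.symm (A.bracket x x) = 0
    have h : (2 : K) • A.bracket x x = 0 := by
      rw [two_smul, ← eq_neg_iff_add_eq_zero]
      exact A.anticomm x x
    rw [(smul_eq_zero_iff_right two_ne_zero).1 h, map_zero]
  leibniz_lie x y z := by
    change a.symm (A.bracket x (a.symm (A.bracket y z))) =
      a.symm (A.bracket (a.symm (A.bracket x y)) z)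
        + a.symm (A.bracket y (a.symm (A.bracket x z)))
    -- At these preimages the twists cancel, and multiplicativity pulls `α⁻¹` out of the inner
    -- brackets.
    have key := A.hom_jacobi (a.symm x) (a.symm y) (a.symm z)
    simp only [← ha, a.apply_symm_apply, ← hmul.symm_bracket ha] at key
    rw [A.anticomm x z, map_neg, map_neg, LinearMap.neg_apply] at key
    rw [← map_add]
    congr 1
    rw [A.anticomm (a.symm (A.bracket y z)) x, A.anticomm (a.symm (A.bracket x z)) y]
    exact (eq_neg_of_add_eq_zero_left key).symm

/-- The untwisted Lie ring is a Lie algebra. -/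
abbrev untwistedLieAlgebra (hmul : A.IsMultiplicative) {a : L ≃ₗ[K] L}
    (ha : ∀ x, a x = A.twist x) : letI := untwistedLieRing hmul ha; LieAlgebra K L :=
  letI := untwistedLieRing hmul ha
  { (inferInstance : Module K L) with
    lie_smul := fun c x y => by
      change a.symm (A.bracket x (c • y)) = c • a.symm (A.bracket x y)
      simp }

theorem untwisted_isNilpotent (hnil : A.IsNilpotent) (hmul : A.IsMultiplicative) {a : L ≃ₗ[K] L}
    (ha : ∀ x, a x = A.twist x) :
    letI := untwistedLieRing hmul ha; LieRing.IsNilpotent L := by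
  let := untwistedLieRing hmul ha
  let := untwistedLieAlgebra hmul ha
  have key : ∀ n, (LieModule.lowerCentralSeries K L L n).toSubmodule ≤ A.lowerCentral n := by
    intro n
    induction n with
    | zero => exact fun _ _ => Submodule.mem_top
    | succ n ih =>
      rw [LieModule.lowerCentralSeries_succ, LieSubmodule.lieIdeal_oper_eq_linear_span',
        Submodule.span_le]
      rintro _ ⟨x, -, y, hy, rfl⟩
      change a.symm (A.bracket x y) ∈ A.lowerCentral (n + 1)
      -- The two lower central series bracket with the whole algebra on opposite sides.
      rw [A.anticomm, map_neg]
      refine neg_mem (symm_mem_lowerCentral hmul ha (n + 1) ?_)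
      exact Submodule.apply_mem_map₂ _ (ih hy) Submodule.mem_top
  obtain ⟨n, hn⟩ := hnil
  refine (LieModule.isNilpotent_iff K L L).2 ⟨n, ?_⟩
  exact (LieSubmodule.toSubmodule_eq_bot _).1 (eq_bot_iff.2 (hn ▸ key n))

end HomLieAlgebra

theorem theorem5p7 (K : Type u) [Field K] [IsAlgClosed K] [CharZero K]
    (L : Type v) [AddCommGroup L] [Module K L] [FiniteDimensional K L]
    (A : HomLieAlgebra K L)
    (hnil : A.IsNilpotent) (hmul : A.IsMultiplicative) (hnd : A.IsNondegenerate) :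
    ∃ (V : Type u) (_ : AddCommGroup V) (_ : Module K V) (ρ : A.Representation V),
      FiniteDimensional K V ∧ ρ.IsFaithful ∧ ρ.IsNilpotent ∧
        ρ.IsMultiplicative ∧ ρ.IsNondegenerate := by
  let a : L ≃ₗ[K] L := LinearEquiv.ofInjectiveEndo A.twist (LinearMap.ker_eq_bot.1 hnd)
  have ha : ∀ x, a x = A.twist x := fun x => rfl
  let := HomLieAlgebra.untwistedLieRing hmul ha
  let := HomLieAlgebra.untwistedLieAlgebra hmul ha
  have := HomLieAlgebra.untwisted_isNilpotent hnil hmul ha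
  let α : L →ₗ⁅K⁆ L :=
    { A.twist with
      map_lie' := fun {x y} => by
        change a (a.symm (A.bracket x y)) = a.symm (A.bracket (a x) (a y))
        rw [a.apply_symm_apply, hmul.symm_bracket ha, a.symm_apply_apply, a.symm_apply_apply] }
  obtain ⟨d, n, π, β, hπ, hker, hn, hβ, hβker⟩ :=
    UniversalEnvelopingAlgebra.exists_equivariant_representation (K := K) α a.surjective
  have hα : ∀ x, α x = A.twist x := fun x => rfl
  have hβ' : ∀ x, π (A.twist x) * β = β * π x := hβ
  have hbr : ∀ x y, A.bracket x y = A.twist ⁅x, y⁆ := fun x y =>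
    (a.apply_symm_apply (A.bracket x y)).symm
  refine ⟨Fin d → K, inferInstance, inferInstance,
    { twist := β
      action := LinearMap.mulLeft K β ∘ₗ π
      action_bracket := fun x y => ?_ }, inferInstance, ?_, ?_, ?_, hβker⟩
  · change β * π (A.bracket x y) * β
      = β * π (A.twist x) * (β * π y) - β * π (A.twist y) * (β * π x)
    rw [hbr, mul_assoc, hβ', hπ]
    have h : ∀ x y, β * π (A.twist x) * (β * π y) = β * (β * (π x * π y)) := fun x y => by
      rw [mul_assoc, ← mul_assoc (π (A.twist x)), hβ', mul_assoc]
    rw [h, h, mul_sub, mul_sub]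
  · refine LinearMap.ker_eq_bot'.2 fun x hx => ?_
    refine LinearMap.ker_eq_bot'.1 hker x (LinearMap.ext fun v => ?_)
    exact LinearMap.ker_eq_bot'.1 hβker _ (LinearMap.congr_fun hx v)
  · refine ⟨n + 1, n.succ_pos, fun x => ?_⟩
    obtain ⟨l, hl, h⟩ := HomLieAlgebra.exists_list_prod_twisted hβ' (List.ofFn x)
    rw [List.map_ofFn] at h
    change (List.ofFn ((fun y => β * π y) ∘ x)).prod = 0
    rw [h, hn l (by rw [hl, List.length_ofFn]; exact n.le_succ), zero_mul]
  · intro x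
    change β * π (A.twist x) * β = β * (β * π x)
    rw [mul_assoc, hβ']
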